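/- Let $\Bbbk$ be a commutative ring and let $Q$ be a quiver with finite vertex set $Q_0$ (arrows arbitrary). Paths are composed like maps, $pq$ meaning first $q$, then $p$; the path algebra $\Bbbk Q$ is the free $\Bbbk$-module on all paths, including the trivial paths $e_i$ $(i\in Q_0)$, where the product of two paths is their composite if they are composable and $0$ otherwise. Let $\Bbbk\bar Q$ be the $\Bbbk$-linear category whose objects are the vertices and whose morphisms $i\to j$ are the formal $\Bbbk$-linear combinations of paths from $i$ to $j$. A relation is a morphism in $\Bbbk\bar Q$; it is admissible if its coefficient at every trivial path $e_i$ is zero. Let $\mathcal R$ be a set of admissible relations and let $I=(\mathcal R)$ be the two-sided ideal of $\Bbbk Q$ generated by $\mathcal R$. One calls $(Q,\mathcal R)$ right rooted if for every infinite sequence $\bullet\xrightarrow{a_1}\bullet\xrightarrow{a_2}\bullet\xrightarrow{a_3}\cdots$ of composable arrows in $Q$ there is an $N\geqslant 1$ such that the path $a_N\cdots a_1$ belongs to the two-sided ideal of $\Bbbk\bar Q$ generated by $\mathcal R$. For an ideal $\mathfrak p$ of $\Bbbk$ and $i\in Q_0$ let $\tilde{\mathfrak p}(i)$ be the set of all $\xi\in\Bbbk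 Q$ whose coefficient at $e_i$ belongs to $\mathfrak p$; this is a two-sided ideal containing $I$. An object $H$ of an abelian category $\mathcal A$ is monoform if $H\neq 0$ and, for every non-zero subobject $N$ of $H$, the objects $H$ and $H/N$ have no common non-zero subobject. Two monoform objects are atom equivalent if they have a common non-zero subobject; $\mathrm{ASpec}\,\mathcal A$ is the collection of the equivalence classes $\langle H\rangle$ of monoform objects. For $M\in\mathcal A$ let $\mathrm{ASupp}\,M$ be the set of all $\langle H\rangle$ with $H$ monoform and $H\cong L/L'$ for some $L'\subseteq L\subseteq M$. A subset $\Phi\subseteq\mathrm{ASpec}\,\mathcal A$ is open if for every $a\in\Phi$ there is a monoform $H$ with $\langle H\rangle=a$ and $\mathrm{ASupp}\,H\subseteq\Phi$; and $\mathrm{ASpec}\,\mathcal A$ is ordered by $a\leqslant b$ if and only if $a\in\overline{\{b\}}$. The set $\mathrm{Spec}\,\Bbbk$ of prime ideals is ordered by inclusion and its open subsets are the specialization-closed ones, i.e. those that with $\mathfrak p$ contain every prime ideal $\mathfrak q\supseteq\mathfrak p$; disjoint unions carry the disjoint union topology and order. **Theorem.** For every $i\in Q_0$ and $\mathfrak p\in\mathrm{Spec}\,\Bbbk$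 the left $\Bbbk Q/I$-module $\Bbbk Q/\tilde{\mathfrak p}(i)$ is monoform, and the map $$\tilde f\colon \bigsqcup_{i\in Q_0}\mathrm{Spec}\,\Bbbk\longrightarrow\mathrm{ASpec}(\mathrm{Mod}\,\Bbbk Q/I),\qquad (i^{\text{th}}\text{ copy of }\mathrm{Spec}\,\Bbbk)\ni\mathfrak p\longmapsto\langle \Bbbk Q/\tilde{\mathfrak p}(i)\rangle,$$ into the atom spectrum of the category of left $\Bbbk Q/I$-modules is injective, continuous, open and order-preserving. If, in addition, $(Q,\mathcal R)$ is right rooted, then $\tilde f$ is also surjective, and hence it is a homeomorphism and an order-isomorphism. -/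

import Mathlib

open CategoryTheory CategoryTheory.Limits

universe w v u

namespace QuiverAtoms

/-! ### Atoms in an abelian category -/

section Atoms

variable {C : Type u} [Category.{v} C] [Abelian C]

/-- An object `H` is monoform if it is non-zero and, for every non-zero subobject `N` of `H`,
the objects `H` and `H / N` have no common non-zero subobject. -/
def IsMonoform (H : C) : Prop :=
  ¬ IsZero H ∧
    ∀ ⦃N : C⦄ (n : N ⟶ H), Mono n → ¬ IsZero N →
      ∀ ⦃X : C⦄ (f : X ⟶ H) (g : X ⟶ cokernel n), Mono f → Mono g → IsZero X

/-- Two objects are atom equivalent if they have a common non-zero subobject. -/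
def AtomEquiv (H H' : C) : Prop :=
  ∃ (X : C) (f : X ⟶ H) (g : X ⟶ H'), Mono f ∧ Mono g ∧ ¬ IsZero X

/-- A non-zero subobject of a monoform object is monoform. -/
theorem IsMonoform.of_mono {H K : C} (hH : IsMonoform H) (m : K ⟶ H) (hm : Mono m)
    (hK : ¬ IsZero K) : IsMonoform K := by
  refine ⟨hK, fun N n hn hN X f g hf hg => ?_⟩
  have sq : IsPullback n (𝟙 N) m (n ≫ m) :=
    IsPullback.of_isLimit' ⟨by simp⟩ (PullbackCone.IsLimit.mk _ (fun s => s.snd)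
      (fun s => by rw [← cancel_mono m, Category.assoc, s.condition])
      (fun s => by simp) (fun s x _ h => by simpa using h))
  have := Abelian.mono_cokernel_map_of_isPullback sq
  exact hH.2 (n ≫ m) (mono_comp n m) hN (f ≫ m) (g ≫ cokernel.map _ _ _ _ sq.w)
    (mono_comp f m) (mono_comp g _)

theorem AtomEquiv.trans_of_isMonoform {H₁ H₂ H₃ : C} (h₂ : IsMonoform H₂)
    (h₁₂ : AtomEquiv H₁ H₂) (h₂₃ : AtomEquiv H₂ H₃) : AtomEquiv H₁ H₃ := by
  obtain ⟨X, f, g, hf, hg, hX⟩ := h₁₂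
  obtain ⟨Y, f', g', hf', hg', hY⟩ := h₂₃
  refine ⟨pullback g f', pullback.fst g f' ≫ f, pullback.snd g f' ≫ g',
    mono_comp _ _, mono_comp _ _, fun h0 => hX ?_⟩
  refine h₂.2 f' hf' hY g (g ≫ cokernel.π f') hg ?_
  rw [Preadditive.mono_iff_cancel_zero]
  intro Z z hz
  rw [← Category.assoc] at hz
  let l : Z ⟶ Y := Abelian.monoLift f' (z ≫ g) hz
  have hl : z ≫ g = l ≫ f' := (Abelian.monoLift_comp f' (z ≫ g) hz).symm
  have : z = pullback.lift z l hl ≫ pullback.fst g f' := (pullback.lift_fst _ _ _).symm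
  rw [this, h0.eq_of_tgt (pullback.lift z l hl) 0, zero_comp]

variable (C) in
/-- Atom equivalence, as an equivalence relation on the monoform objects. -/
def atomSetoid : Setoid {H : C // IsMonoform H} where
  r H H' := AtomEquiv H.1 H'.1
  iseqv :=
    { refl := fun H => ⟨H.1, 𝟙 _, 𝟙 _, inferInstance, inferInstance, H.2.1⟩
      symm := fun ⟨X, f, g, hf, hg, hX⟩ => ⟨X, g, f, hg, hf, hX⟩
      trans := fun {_ H₂ _} h h' => AtomEquiv.trans_of_isMonoform H₂.2 h h' }

variable (C) in
/-- The atom spectrum of `C`: the collection of equivalence classes of monoform objects. -/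
def ASpec : Type u := Quotient (atomSetoid C)

/-- The atom of a monoform object. -/
def atom (H : C) (hH : IsMonoform H) : ASpec C := Quotient.mk (atomSetoid C) ⟨H, hH⟩

/-- The atom support of `M`: the atoms of the monoform objects of the form `L / L'`
with `L' ⊆ L ⊆ M`. -/
def ASupp (M : C) : Set (ASpec C) :=
  {a | ∃ (H : C) (hH : IsMonoform H), atom H hH = a ∧
    ∃ (L L' : C) (i : L ⟶ M) (j : L' ⟶ L), Mono i ∧ Mono j ∧ Nonempty (H ≅ cokernel j)}

theorem ASupp_subset_of_mono {M N : C} (m : M ⟶ N) (hm : Mono m) : ASupp M ⊆ ASupp N := by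
  rintro a ⟨H, hH, rfl, L, L', i, j, hi, hj, e⟩
  exact ⟨H, hH, rfl, L, L', i ≫ m, j, mono_comp _ _, hj, e⟩

/-- The localization topology: `Φ` is open if every atom in `Φ` is the atom of some monoform
object whose atom support is contained in `Φ`. -/
instance : TopologicalSpace (ASpec C) where
  IsOpen Φ := ∀ a ∈ Φ, ∃ (H : C) (hH : IsMonoform H), atom H hH = a ∧ ASupp H ⊆ Φ
  isOpen_univ := fun a _ => by
    obtain ⟨⟨H, hH⟩, rfl⟩ := Quotient.exists_rep a
    exact ⟨H, hH, rfl, Set.subset_univ _⟩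
  isOpen_inter := fun Φ Ψ hΦ hΨ a ha => by
    obtain ⟨H, hH, rfl, hHΦ⟩ := hΦ a ha.1
    obtain ⟨H', hH', he, hHΨ⟩ := hΨ _ ha.2
    obtain ⟨X, f, g, hf, hg, hX⟩ : AtomEquiv H' H := Quotient.exact he
    have hXm := hH'.of_mono f hf hX
    refine ⟨X, hXm, Quotient.sound ⟨X, 𝟙 _, g, inferInstance, hg, hX⟩, fun b hb => ?_⟩
    exact ⟨hHΦ (ASupp_subset_of_mono g hg hb), hHΨ (ASupp_subset_of_mono f hf hb)⟩
  isOpen_sUnion := fun S hS a ⟨Φ, hΦ, ha⟩ => by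
    obtain ⟨H, hH, he, hs⟩ := hS Φ hΦ a ha
    exact ⟨H, hH, he, fun b hb => ⟨Φ, hΦ, hs hb⟩⟩

/-- The specialization order on the atom spectrum: `a ≤ b` means that `a` lies in the closure
of `{b}`. -/
instance : Preorder (ASpec C) := specializationPreorder (ASpec C)

theorem ASpec.le_iff (a b : ASpec C) : a ≤ b ↔ a ∈ closure {b} := specializes_iff_mem_closure

end Atoms

/-! ### The prime spectrum with the specialization-closed topology -/

section Spec

variable (k : Type u) [CommRing k]

/-- The set of prime ideals of `k`, ordered by inclusion, in which the open sets are the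
specialization-closed ones. (It is a synonym of `PrimeSpectrum k`, which carries the Zariski
topology.) -/
def SpecSC : Type u := PrimeSpectrum k

instance : PartialOrder (SpecSC k) := inferInstanceAs (PartialOrder (PrimeSpectrum k))

instance : TopologicalSpace (SpecSC k) where
  IsOpen U := ∀ ⦃p q : SpecSC k⦄, p ≤ q → p ∈ U → q ∈ U
  isOpen_univ := fun _ _ _ _ => trivial
  isOpen_inter := fun _ _ h h' _ _ hpq hp => ⟨h hpq hp.1, h' hpq hp.2⟩
  isOpen_sUnion := fun _ h _ _ hpq ⟨U, hU, hp⟩ => ⟨U, hU, h U hU hpq hp⟩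

variable {k} in
/-- The underlying ideal of a point. -/
def SpecSC.asIdeal (p : SpecSC k) : Ideal k := PrimeSpectrum.asIdeal p

theorem SpecSC.isPrime (p : SpecSC k) : p.asIdeal.IsPrime := PrimeSpectrum.isPrime p

theorem SpecSC.le_iff (p q : SpecSC k) : p ≤ q ↔ p.asIdeal ≤ q.asIdeal := Iff.rfl

end Spec

/-! ### Path algebras -/

section PathAlgebra

variable (k : Type u) [CommRing k] (V : Type v) [Quiver.{w} V]

/-- The type of all paths in a quiver: triples (source, target, path). -/
abbrev AllPaths : Type max v w := Σ i j : V, Quiver.Path i j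

variable {V} in
/-- The trivial path at the vertex `i`. -/
def trivialPath (i : V) : AllPaths V := ⟨i, i, Quiver.Path.nil⟩

/-- The underlying `k`-module of the path algebra `kQ`: it is free with basis all paths. -/
def PathAlgebra : Type max u v w := AllPaths V →₀ k

noncomputable instance : AddCommGroup (PathAlgebra k V) :=
  inferInstanceAs (AddCommGroup (AllPaths V →₀ k))

noncomputable instance : Module k (PathAlgebra k V) :=
  inferInstanceAs (Module k (AllPaths V →₀ k))

namespace PathAlgebra

variable {V}

/-- The coefficient of `ξ` at the path `p`. -/
def coeff (p : AllPaths V) : PathAlgebra k V →ₗ[k] k := Finsupp.lapply p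

/-- A path, as an element of the path algebra. -/
noncomputable def ofPath (p : AllPaths V) : PathAlgebra k V := Finsupp.single p (1 : k)

variable {k} in
/-- Linear maps out of the path algebra agree if they agree on paths. -/
theorem hom_ext {M : Type*} [AddCommMonoid M] [Module k M] {f g : PathAlgebra k V →ₗ[k] M}
    (h : ∀ p, f (ofPath k p) = g (ofPath k p)) : f = g :=
  Finsupp.lhom_ext' fun p => LinearMap.ext_ring (h p)

open Classical in
/-- The product `p q` of two paths: first `q`, then `p`, if the target of `q` is the source
of `p`, and zero otherwise. -/
noncomputable def pathMul (p q : AllPaths V) : PathAlgebra k V :=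
  if h : q.2.1 = p.1 then ofPath k ⟨q.1, p.2.1, (q.2.2.cast rfl h).comp p.2.2⟩ else 0

/-- The bilinear extension of the product of paths. -/
noncomputable def mulHom : PathAlgebra k V →ₗ[k] PathAlgebra k V →ₗ[k] PathAlgebra k V :=
  Finsupp.lift _ k _ fun p => Finsupp.lift _ k _ fun q => pathMul k p q

noncomputable instance : Mul (PathAlgebra k V) := ⟨fun ξ η => mulHom k ξ η⟩

theorem mul_def (ξ η : PathAlgebra k V) : ξ * η = mulHom k ξ η := rfl

theorem ofPath_mul_ofPath (p q : AllPaths V) : ofPath k p * ofPath k q = pathMul k p q := by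
  have h : ∀ {M : Type (max u v w)} [AddCommGroup M] [Module k M] (F : AllPaths V → M)
      (p : AllPaths V), Finsupp.lift M k (AllPaths V) F (Finsupp.single p 1) = F p :=
    fun F p => by
      rw [Finsupp.lift_apply, Finsupp.sum_single_index (by rw [zero_smul]), one_smul]
  exact (LinearMap.congr_fun (h (fun p => Finsupp.lift (PathAlgebra k V) k (AllPaths V)
    fun q => pathMul k p q) p) (ofPath k q)).trans (h (fun q => pathMul k p q) q)

theorem pathMul_comp {i j l : V} (p : Quiver.Path j l) (q : Quiver.Path i j) :
    pathMul k ⟨j, l, p⟩ ⟨i, j, q⟩ = ofPath k ⟨i, l, q.comp p⟩ := by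
  simp [pathMul]

theorem pathMul_of_ne {p q : AllPaths V} (h : q.2.1 ≠ p.1) : pathMul k p q = 0 := by
  simp [pathMul, h]

theorem mul_assoc_ofPath (p q r : AllPaths V) :
    ofPath k p * ofPath k q * ofPath k r = ofPath k p * (ofPath k q * ofPath k r) := by
  obtain ⟨i, j, p⟩ := p
  obtain ⟨i', j', q⟩ := q
  obtain ⟨i'', j'', r⟩ := r
  simp only [ofPath_mul_ofPath]
  by_cases h : j' = i
  · subst h
    by_cases h' : j'' = i'
    · subst h'
      simp [pathMul_comp, ofPath_mul_ofPath]
    · rw [pathMul_comp, ofPath_mul_ofPath, pathMul_of_ne k h', pathMul_of_ne k h']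
      simp [mul_def]
  · rw [pathMul_of_ne k h]
    by_cases h' : j'' = i'
    · subst h'
      rw [pathMul_comp, ofPath_mul_ofPath, pathMul_of_ne k h]
      simp [mul_def]
    · rw [pathMul_of_ne k h']
      simp [mul_def]

theorem mul_assoc' (a b c : PathAlgebra k V) :
    mulHom k (mulHom k a b) c = mulHom k a (mulHom k b c) := by
  have h1 : ∀ p q (c : PathAlgebra k V), mulHom k (mulHom k (ofPath k p) (ofPath k q)) c =
      mulHom k (ofPath k p) (mulHom k (ofPath k q) c) := fun p q =>
    LinearMap.congr_fun (f := mulHom k (mulHom k (ofPath k p) (ofPath k q)))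
      (g := mulHom k (ofPath k p) ∘ₗ mulHom k (ofPath k q))
      (hom_ext fun r => mul_assoc_ofPath k p q r)
  have h2 : ∀ p (c b : PathAlgebra k V), mulHom k (mulHom k (ofPath k p) b) c =
      mulHom k (ofPath k p) (mulHom k b c) := fun p c =>
    LinearMap.congr_fun (f := (mulHom k).flip c ∘ₗ mulHom k (ofPath k p))
      (g := mulHom k (ofPath k p) ∘ₗ (mulHom k).flip c)
      (hom_ext fun q => h1 p q c)
  exact LinearMap.congr_fun (f := (mulHom k).flip c ∘ₗ (mulHom k).flip b)
    (g := (mulHom k).flip (mulHom k b c)) (hom_ext fun p => h2 p c b) a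

variable [Fintype V]

noncomputable instance : One (PathAlgebra k V) := ⟨∑ i : V, ofPath k (trivialPath i)⟩

theorem one_def : (1 : PathAlgebra k V) = ∑ i : V, ofPath k (trivialPath i) := rfl

theorem one_mul_ofPath (p : AllPaths V) : 1 * ofPath k p = ofPath k p := by
  obtain ⟨i, j, p⟩ := p
  have : ∀ l : V, l ≠ j → mulHom k (ofPath k (trivialPath l)) (ofPath k ⟨i, j, p⟩) = 0 :=
    fun l hl => by
      rw [← mul_def, ofPath_mul_ofPath, pathMul_of_ne]
      exact fun h => hl h.symm
  rw [one_def, mul_def, map_sum, LinearMap.sum_apply,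
    Finset.sum_eq_single j (fun l _ hl => this l hl) (by simp), ← mul_def, ofPath_mul_ofPath]
  exact pathMul_comp k _ _

theorem ofPath_mul_one (p : AllPaths V) : ofPath k p * 1 = ofPath k p := by
  obtain ⟨i, j, p⟩ := p
  have : ∀ l : V, l ≠ i → mulHom k (ofPath k ⟨i, j, p⟩) (ofPath k (trivialPath l)) = 0 :=
    fun l hl => by
      rw [← mul_def, ofPath_mul_ofPath, pathMul_of_ne]
      exact hl
  rw [one_def, mul_def, map_sum,
    Finset.sum_eq_single i (fun l _ hl => this l hl) (by simp), ← mul_def, ofPath_mul_ofPath]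
  refine (pathMul_comp k _ _).trans ?_
  simp

theorem one_mul' (a : PathAlgebra k V) : 1 * a = a := by
  have h : mulHom k 1 = (LinearMap.id : PathAlgebra k V →ₗ[k] PathAlgebra k V) :=
    hom_ext fun p => one_mul_ofPath k p
  exact LinearMap.congr_fun h a

theorem mul_one' (a : PathAlgebra k V) : a * 1 = a := by
  have h : (mulHom k).flip 1 = (LinearMap.id : PathAlgebra k V →ₗ[k] PathAlgebra k V) :=
    hom_ext fun p => ofPath_mul_one k p
  exact LinearMap.congr_fun h a

/-- The path algebra of a quiver with finitely many vertices, with unit the sum of the trivial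
paths. -/
noncomputable instance : Ring (PathAlgebra k V) where
  __ := (inferInstance : AddCommGroup (PathAlgebra k V))
  mul ξ η := mulHom k ξ η
  one := ∑ i : V, ofPath k (trivialPath i)
  left_distrib a b c := map_add (mulHom k a) b c
  right_distrib a b c := by
    change mulHom k (a + b) c = _
    rw [map_add]; rfl
  zero_mul a := by
    change mulHom k 0 a = 0
    rw [map_zero]; rfl
  mul_zero a := map_zero (mulHom k a)
  mul_assoc a b c := mul_assoc' k a b c
  one_mul a := one_mul' k a
  mul_one a := mul_one' k a

noncomputable instance : Algebra k (PathAlgebra k V) :=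
  Algebra.ofModule (fun x a b => by
      change mulHom k (x • a) b = x • mulHom k a b
      rw [map_smul]; rfl)
    (fun x a b => map_smul (mulHom k a) x b)

/-- The coefficient at a trivial path is multiplicative. -/
theorem coeff_trivialPath_mul (i : V) (ξ η : PathAlgebra k V) :
    coeff k (trivialPath i) (ξ * η) = coeff k (trivialPath i) ξ * coeff k (trivialPath i) η := by
  have h0 : ∀ p q : AllPaths V, coeff k (trivialPath i) (pathMul k p q) =
      coeff k (trivialPath i) (ofPath k p) * coeff k (trivialPath i) (ofPath k q) := by
    intro p q
    have hc : ∀ p : AllPaths V, p ≠ trivialPath i → coeff k (trivialPath i) (ofPath k p) = 0 :=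
      fun p hp => Finsupp.single_eq_of_ne hp.symm
    have hc1 : coeff k (trivialPath i) (ofPath k (trivialPath i)) = 1 := Finsupp.single_eq_same
    obtain ⟨a, b, p⟩ := p
    obtain ⟨c, d, q⟩ := q
    by_cases h : d = a
    · subst h
      rw [pathMul_comp]
      cases p with
      | cons p e =>
        have h2 : ∀ {x y z : V} (s : Quiver.Path x y) (t : y ⟶ z),
            (⟨x, z, s.cons t⟩ : AllPaths V) ≠ trivialPath i := by
          intro x y z s t h
          exact absurd (congrArg (fun q : AllPaths V => q.2.2.length) h) (Nat.succ_ne_zero _)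
        rw [Quiver.Path.comp_cons, hc _ (h2 _ _), hc _ (h2 _ _), zero_mul]
      | nil =>
        rw [Quiver.Path.comp_nil]
        by_cases hd : b = i
        · subst hd
          exact ((congrArg (· * _) hc1).trans (one_mul _)).symm
        · rw [hc ⟨c, b, q⟩ (fun h => ?_), mul_zero]
          obtain rfl : c = i := congrArg Sigma.fst h
          exact hd (congrArg Sigma.fst (eq_of_heq (Sigma.mk.inj h).2))
    · rw [pathMul_of_ne k h, map_zero]
      by_cases hp : (⟨a, b, p⟩ : AllPaths V) = trivialPath i
      · rw [hc ⟨c, d, q⟩ (fun hq => h ?_), mul_zero]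
        obtain rfl : c = i := congrArg Sigma.fst hq
        exact (congrArg Sigma.fst (eq_of_heq (Sigma.mk.inj hq).2)).trans
          (congrArg Sigma.fst hp).symm
      · rw [hc _ hp, zero_mul]
  have h1 : ∀ p (η : PathAlgebra k V), coeff k (trivialPath i) (mulHom k (ofPath k p) η) =
      coeff k (trivialPath i) (ofPath k p) * coeff k (trivialPath i) η := fun p =>
    LinearMap.congr_fun (f := coeff k (trivialPath i) ∘ₗ mulHom k (ofPath k p))
      (g := coeff k (trivialPath i) (ofPath k p) • coeff k (trivialPath i))
      (hom_ext fun q => (congrArg _ (ofPath_mul_ofPath k p q)).trans (h0 p q))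
  exact LinearMap.congr_fun (f := coeff k (trivialPath i) ∘ₗ (mulHom k).flip η)
    (g := (LinearMap.mul k k).flip (coeff k (trivialPath i) η) ∘ₗ coeff k (trivialPath i))
    (hom_ext fun p => h1 p η) ξ

end PathAlgebra

variable {k V}

/-- For an ideal `p` of `k` and a vertex `i`, the set of all `ξ` in the path algebra whose
coefficient at the trivial path `e_i` belongs to `p`. -/
def idealTilde [Fintype V] (p : Ideal k) (i : V) : Ideal (PathAlgebra k V) where
  carrier := {ξ | PathAlgebra.coeff k (trivialPath i) ξ ∈ p}
  add_mem' {a b} ha hb := by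
    simpa only [Set.mem_ofPred_eq, map_add] using p.add_mem ha hb
  zero_mem' := by simp
  smul_mem' c x hx := by
    simpa only [Set.mem_ofPred_eq, smul_eq_mul, PathAlgebra.coeff_trivialPath_mul]
      using p.mul_mem_left _ hx

instance [Fintype V] (p : Ideal k) (i : V) : (idealTilde p i).IsTwoSided where
  mul_mem_of_left {a} b ha := by
    change PathAlgebra.coeff k (trivialPath i) (a * b) ∈ p
    rw [PathAlgebra.coeff_trivialPath_mul]
    exact p.mul_mem_right _ ha

end PathAlgebra

/-! ### Quivers with relations -/

section Relations

variable (k : Type u) [CommRing k] (V : Type v) [Quiver.{w} V]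

/-- The `k`-linearization of the path category of a quiver: its objects are the vertices, and the
morphisms from `i` to `j` are the formal `k`-linear combinations of paths from `i` to `j`. -/
abbrev LinPaths : Type v := Free k (Paths V)

variable {V} in
/-- A vertex, as an object of the linearized path category. -/
def vertex (i : V) : LinPaths k V := Free.of k ((Paths.of V).obj i)

variable {V} in
/-- A path, as a morphism of the linearized path category. -/
noncomputable def linPath {i j : V} (p : Quiver.Path i j) : vertex k i ⟶ vertex k j :=
  (Free.embedding k (Paths V)).map (X := (Paths.of V).obj i) (Y := (Paths.of V).obj j) p

/-- A relation in a quiver: a morphism in the linearized path category, i.e. a `k`-linear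
combination of paths with a common source and a common target. -/
structure Relation where
  /-- the common source -/
  src : V
  /-- the common target -/
  tgt : V
  /-- the linear combination -/
  hom : vertex k src ⟶ vertex k tgt

variable {k V}

/-- A relation viewed as an element of the path algebra. -/
noncomputable def Relation.toPathAlgebra (ρ : Relation k V) : PathAlgebra k V :=
  Finsupp.mapDomain (fun p : Quiver.Path ρ.src ρ.tgt => (⟨ρ.src, ρ.tgt, p⟩ : AllPaths V))
    ρ.hom

/-- A relation is admissible if its coefficient at every trivial path is zero. -/
def Relation.IsAdmissible (ρ : Relation k V) : Prop :=
  ∀ i : V, PathAlgebra.coeff k (trivialPath i) ρ.toPathAlgebra = 0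

/-- The two-sided ideal `(R)` in the linearized path category generated by a set of relations:
`(R)(X, Y)` consists of the finite sums of scalar multiples of composites `α ≫ φ ≫ β` with
`φ ∈ R`. -/
noncomputable def catIdeal (R : Set (Relation k V)) (X Y : LinPaths k V) : Submodule k (X ⟶ Y) :=
  Submodule.span k {f | ∃ ρ ∈ R, ∃ (α : X ⟶ vertex k ρ.src) (β : vertex k ρ.tgt ⟶ Y),
    f = α ≫ ρ.hom ≫ β}

/-- For a sequence `a 0, a 1, a 2, …` of composable arrows, the path `a (n - 1) ⋯ a 1 a 0` formed
by the first `n` arrows. -/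
def initialPath (x : ℕ → V) (a : ∀ n, x n ⟶ x (n + 1)) : ∀ n, Quiver.Path (x 0) (x n)
  | 0 => Quiver.Path.nil
  | n + 1 => (initialPath x a n).cons (a n)

/-- A quiver with relations is right rooted if for every infinite sequence of composable arrows
some non-empty initial path of it belongs to the two-sided ideal generated by the relations. -/
def IsRightRooted (R : Set (Relation k V)) : Prop :=
  ∀ (x : ℕ → V) (a : ∀ n, x n ⟶ x (n + 1)), ∃ N, 1 ≤ N ∧
    linPath k (initialPath x a N) ∈ catIdeal R (vertex k (x 0)) (vertex k (x N))

variable [Fintype V]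

/-- The two-sided ideal `I = (R)` of the path algebra generated by a set of relations. -/
noncomputable def relIdeal (R : Set (Relation k V)) : Ideal (PathAlgebra k V) :=
  (TwoSidedIdeal.span (Relation.toPathAlgebra '' R)).asIdeal

instance (R : Set (Relation k V)) : (relIdeal R).IsTwoSided :=
  inferInstanceAs (TwoSidedIdeal.asIdeal _).IsTwoSided

/-- The algebra `kQ / I`. -/
abbrev QuotAlgebra (R : Set (Relation k V)) : Type max u v w := PathAlgebra k V ⧸ relIdeal R

theorem relIdeal_le {R : Set (Relation k V)} (hR : ∀ ρ ∈ R, ρ.IsAdmissible)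
    (p : Ideal k) (i : V) : relIdeal R ≤ idealTilde p i := by
  have h : TwoSidedIdeal.span (Relation.toPathAlgebra '' R) ≤ (idealTilde p i).toTwoSided := by
    rw [TwoSidedIdeal.span_le]
    rintro _ ⟨ρ, hρ, rfl⟩
    rw [SetLike.mem_coe, Ideal.mem_toTwoSided]
    change PathAlgebra.coeff k (trivialPath i) _ ∈ p
    rw [hR ρ hρ i]
    exact p.zero_mem
  intro x hx
  exact Ideal.mem_toTwoSided.1 (h (TwoSidedIdeal.mem_asIdeal.1 hx))

/-- The left `kQ / I`-module `kQ / p̃(i)`; the action of `kQ / I` is the one induced by the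
canonical map `kQ / I → kQ / p̃(i)`, which exists because `I ⊆ p̃(i)`. -/
noncomputable def stalkModule {R : Set (Relation k V)} (hR : ∀ ρ ∈ R, ρ.IsAdmissible)
    (p : Ideal k) (i : V) : ModuleCat.{max u v w} (QuotAlgebra R) :=
  (ModuleCat.restrictScalars (Ideal.Quotient.factor (relIdeal_le hR p i))).obj
    (ModuleCat.of (PathAlgebra k V ⧸ idealTilde p i) (PathAlgebra k V ⧸ idealTilde p i))

end Relations

end QuiverAtoms

open QuiverAtoms

/-! Taking the coefficient at `e_i` gives a ring map `augmentation` from kQ/I to k, split by the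
scalars, and kQ/p̃(i) is k/p with kQ/I acting through it. When p is prime, every non-zero element of
this module has annihilator exactly the preimage of p. This makes it monoform, and its atom is
detected by annihilators: a monoform H has this atom iff some element of H has that annihilator
(`atom_eq_stalkAtom_iff`). Injectivity follows by comparing annihilators.

Conversely, in a monoform module the scalars killing a non-zero element form a prime ideal
(`IsMonoform.smul_eq_zero_or`). Hence an element killed by the kernel of the augmentation at i
identifies the atom (`exists_atom_eq_stalkAtom`). Applied to subquotients of k/p this bounds the
atom support by the primes above p, giving openness; the surjections k/p → k/q for p ⊆ q give
continuity. Both orders are specialization orders, so the order statements follow from the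
topological ones.

In the right rooted case, any non-zero element can be pushed along arrows to a non-zero one killed
by all arrows. Such an element, located at i, is killed by the kernel of the augmentation at i, so
every atom is reached. -/

namespace QuiverAtoms

/-! ### Cyclic modules, annihilators and monoform modules -/

section Modules

theorem exists_linearMap_of_generator {A M N : Type*} [Ring A] [AddCommGroup M] [Module A M]
    [AddCommGroup N] [Module A N] {m : M} {n : N} (hm : ∀ y, ∃ a : A, a • m = y)
    (h : ∀ a : A, a • m = 0 → a • n = 0) :
    ∃ f : M →ₗ[A] N, ∀ a : A, f (a • m) = a • n := by
  choose c hc using hm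
  have key : ∀ a b : A, a • m = b • m → a • n = b • n := fun a b hab => by
    rw [← sub_eq_zero, ← sub_smul] at hab ⊢
    exact h _ hab
  refine ⟨{ toFun := fun y => c y • n, map_add' := fun x y => ?_, map_smul' := fun a x => ?_ },
    fun a => key _ _ (hc _)⟩
  · rw [← add_smul]
    exact key _ _ (by rw [hc, add_smul, hc, hc])
  · rw [RingHom.id_apply, smul_smul]
    exact key _ _ (by rw [hc, mul_smul, hc])

variable {A : Type*} [Ring A]

theorem exists_hom_of_generator {M N : ModuleCat.{v} A} {m : M} {n : N}
    (hm : ∀ y, ∃ a : A, a • m = y) (h : ∀ a : A, a • m = 0 → a • n = 0) :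
    ∃ f : M ⟶ N, ∀ a : A, f (a • m) = a • n :=
  let ⟨f, hf⟩ := exists_linearMap_of_generator hm h
  ⟨ModuleCat.ofHom f, hf⟩

theorem exists_ne_zero_of_not_isZero {H : ModuleCat.{v} A} (hH : ¬ IsZero H) : ∃ x : H, x ≠ 0 := by
  by_contra! h
  have : Subsingleton H := ⟨fun x y => (h x).trans (h y).symm⟩
  exact hH (ModuleCat.isZero_of_subsingleton H)

theorem not_isZero_of_ne_zero {H : ModuleCat.{v} A} {x : H} (hx : x ≠ 0) : ¬ IsZero H :=
  fun h => hx (congrArg (fun f : H ⟶ H => f x) (h.eq_of_src (𝟙 H) 0))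

theorem map_ne_zero_of_mono {M N : ModuleCat.{v} A} (f : M ⟶ N) (hf : Mono f) {x : M}
    (hx : x ≠ 0) : f x ≠ 0 := fun h =>
  hx ((ModuleCat.mono_iff_injective f).1 hf (h.trans (map_zero f.hom).symm))

theorem smul_eq_zero_iff_of_mono {M N : ModuleCat.{v} A} (f : M ⟶ N) (hf : Mono f) (a : A)
    (x : M) : a • f x = 0 ↔ a • x = 0 := by
  rw [← not_iff_not]
  refine ⟨fun h h' => h ?_, fun h h' => map_ne_zero_of_mono f hf h ?_⟩
  · rw [← map_smul f.hom, h', map_zero f.hom]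
  · rw [map_smul f.hom, h']

theorem cokernel_π_eq_zero_iff {M N : ModuleCat.{v} A} (f : M ⟶ N) (y : N) :
    cokernel.π f y = 0 ↔ ∃ x, f x = y := by
  refine ⟨fun h => ?_, ?_⟩
  · exact ((ShortComplex.moduleCat_exact_iff _).1 (ShortComplex.exact_cokernel f)) y h
  · rintro ⟨x, rfl⟩
    exact congrArg (fun g : M ⟶ cokernel f => g x) (cokernel.condition f)

theorem cokernel_π_surjective {M N : ModuleCat.{v} A} (f : M ⟶ N) :
    Function.Surjective (cokernel.π f) :=
  (ModuleCat.epi_iff_surjective _).1 inferInstance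

/-- A monoform module over a `k`-algebra: the scalars killing a given non-zero element form a
prime ideal. -/
theorem IsMonoform.smul_eq_zero_or {k : Type*} [CommRing k] [Algebra k A] {H : ModuleCat.{v} A}
    (hH : IsMonoform H) (x : H) (c d : k)
    (hcd : algebraMap k A c • algebraMap k A d • x = 0) :
    algebraMap k A c • x = 0 ∨ algebraMap k A d • x = 0 := by
  by_contra! hne
  obtain ⟨hc, hd⟩ := hne
  -- N consists of the a • x with a • d • x = 0, and it contains c • x ≠ 0. The image of x in H/N
  -- then has the same annihilator as d • x, so H and H/N share the non-zero submodule generated by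
  -- d • x.
  let N : Submodule A H := (LinearMap.ker (LinearMap.toSpanSingleton A H
    (algebraMap k A d • x))).map (LinearMap.toSpanSingleton A H x)
  have hN : ∀ a : A, a • x ∈ N ↔ a • algebraMap k A d • x = 0 := by
    intro a
    refine ⟨?_, fun h => ⟨a, h, rfl⟩⟩
    rintro ⟨b, hb, hba⟩
    have hb : b • algebraMap k A d • x = 0 := hb
    have hba : b • x = a • x := hba
    -- Since d is central, a • d • x depends only on a • x.
    rw [smul_smul, ← Algebra.commutes, mul_smul] at hb ⊢
    rw [← hba, hb]
  let n : ModuleCat.of A N ⟶ H := ModuleCat.ofHom N.subtype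
  have hn : Mono n := (ModuleCat.mono_iff_injective n).2 Subtype.val_injective
  have hn0 : ¬ IsZero (ModuleCat.of A N) :=
    not_isZero_of_ne_zero (x := (⟨algebraMap k A c • x, (hN _).2 hcd⟩ : N))
      fun h => hc (congrArg Subtype.val h)
  let S : Submodule A H := Submodule.span A {algebraMap k A d • x}
  let s : S := ⟨algebraMap k A d • x, Submodule.mem_span_singleton_self _⟩
  have hs : ∀ y : S, ∃ a : A, a • s = y := by
    rintro ⟨y, hy⟩
    obtain ⟨a, rfl⟩ := Submodule.mem_span_singleton.1 hy
    exact ⟨a, rfl⟩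
  have hπ : ∀ a : A, a • cokernel.π n x = 0 ↔ a • s = 0 := by
    intro a
    rw [← map_smul (cokernel.π n).hom]
    refine (cokernel_π_eq_zero_iff n (a • x)).trans ?_
    refine Iff.trans (b := a • x ∈ N) ⟨?_, fun h => ⟨⟨_, h⟩, rfl⟩⟩ 
      ((hN a).trans ⟨fun h => Subtype.ext h, congrArg Subtype.val⟩)
    rintro ⟨y, hy⟩
    have hy : (y : N).1 = a • x := hy
    exact hy ▸ y.2
  obtain ⟨g, hg⟩ := exists_linearMap_of_generator (n := cokernel.π n x) hs
    fun a h => (hπ a).2 h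
  have hgm : Mono (ModuleCat.ofHom g) := by
    rw [ModuleCat.mono_iff_injective]
    refine (injective_iff_map_eq_zero g).2 fun y hy => ?_
    obtain ⟨a, rfl⟩ := hs y
    rw [hg] at hy
    exact (hπ a).1 hy
  refine not_isZero_of_ne_zero (H := ModuleCat.of A S) (x := s)
    (fun h => hd (congrArg Subtype.val h)) ?_
  exact hH.2 n hn hn0 (ModuleCat.ofHom S.subtype) (ModuleCat.ofHom g)
    ((ModuleCat.mono_iff_injective _).2 Subtype.val_injective) hgm

theorem mem_ASupp_of_epi {C : Type u} [Category.{v} C] [Abelian C] {M L H : C} (hH : IsMonoform H)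
    (m : L ⟶ M) (hm : Mono m) (q : L ⟶ H) (hq : Epi q) : atom H hH ∈ ASupp M :=
  ⟨H, hH, rfl, L, kernel q, m, kernel.ι q, hm, inferInstance,
    ⟨(Abelian.epiIsCokernelOfKernel _ (limit.isLimit _)).coconePointUniqueUpToIso
      (colimit.isColimit (parallelPair (kernel.ι q) 0))⟩⟩

theorem smul_eq_zero_of_subquotient {M L L' H : ModuleCat.{v} A} (i : L ⟶ M) (hi : Mono i)
    (j : L' ⟶ L) (e : H ≅ cokernel j) {a : A} (ha : ∀ x : M, a • x = 0) (y : H) :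
    a • y = 0 := by
  refine (smul_eq_zero_iff_of_mono e.hom inferInstance a y).1 ?_
  obtain ⟨z, hz⟩ := cokernel_π_surjective j (e.hom y)
  rw [← hz, ← map_smul (cokernel.π j).hom,
    (smul_eq_zero_iff_of_mono i hi a z).1 (ha _), map_zero]

end Modules

/-- The open sets of the disjoint union are its upper sets, so the smallest open neighbourhood of x
is the set of points above x. -/
theorem specializes_sigma_iff {k : Type u} [CommRing k] {V : Type v}
    (x y : Σ _ : V, SpecSC k) : y ⤳ x ↔ x ≤ y := by
  refine ⟨fun h => ?_, ?_⟩
  · refine h.mem_open (s := {z | x ≤ z}) (isOpen_sigma_iff.2 fun i p q hpq hp => ?_)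
      (le_refl x)
    exact le_trans (b := (⟨i, p⟩ : Σ _ : V, SpecSC k)) hp (Sigma.le_def.2 ⟨rfl, hpq⟩)
  · rintro ⟨i, p, q, hpq⟩
    exact specializes_iff_forall_open.2 fun U hU hp => isOpen_sigma_iff.1 hU i hpq hp

/-! ### The augmentations and the modules kQ/p̃(i) -/

section Augmentation

variable {k : Type u} [CommRing k] {V : Type v} [Quiver.{w} V]

theorem coeff_trivialPath_self (i : V) :
    PathAlgebra.coeff k (trivialPath i) (PathAlgebra.ofPath k (trivialPath i)) = 1 :=
  Finsupp.single_eq_same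

theorem coeff_ofPath_of_ne {p q : AllPaths V} (h : p ≠ q) :
    PathAlgebra.coeff k p (PathAlgebra.ofPath k q) = 0 :=
  Finsupp.single_eq_of_ne h

theorem trivialPath_injective : Function.Injective (trivialPath : V → AllPaths V) :=
  fun _ _ h => congrArg Sigma.fst h

variable [Fintype V]

theorem coeff_trivialPath_one (i : V) :
    PathAlgebra.coeff k (trivialPath i) (1 : PathAlgebra k V) = 1 := by
  classical
  rw [PathAlgebra.one_def, map_sum, Finset.sum_eq_single i, coeff_trivialPath_self]
  · exact fun j _ hj => coeff_ofPath_of_ne fun h => hj (trivialPath_injective h).symm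
  · simp

/-- The coefficient at a trivial path, as a ring homomorphism. -/
noncomputable def coeffHom (i : V) : PathAlgebra k V →+* k where
  toFun := PathAlgebra.coeff k (trivialPath i)
  map_one' := coeff_trivialPath_one i
  map_mul' := PathAlgebra.coeff_trivialPath_mul k i
  map_zero' := map_zero _
  map_add' := map_add _

variable {R : Set (Relation k V)} (hR : ∀ ρ ∈ R, ρ.IsAdmissible)

/-- The augmentation of `kQ / I` at a vertex. -/
noncomputable def augmentation (i : V) : QuotAlgebra R →+* k :=
  Ideal.Quotient.lift (relIdeal R) (coeffHom i) fun a ha => by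
    -- For the zero ideal, `idealTilde` is the kernel of `coeffHom i`.
    have : a ∈ idealTilde (⊥ : Ideal k) i := relIdeal_le hR ⊥ i ha
    exact this

theorem augmentation_mk (i : V) (ξ : PathAlgebra k V) :
    augmentation hR i (Ideal.Quotient.mk (relIdeal R) ξ) =
      PathAlgebra.coeff k (trivialPath i) ξ := rfl

theorem augmentation_algebraMap (i : V) (c : k) :
    augmentation hR i (algebraMap k (QuotAlgebra R) c) = c := by
  change PathAlgebra.coeff k (trivialPath i) (algebraMap k (PathAlgebra k V) c) = c
  rw [Algebra.algebraMap_eq_smul_one, map_smul, coeff_trivialPath_one, smul_eq_mul, mul_one]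

/-- The canonical generator of `kQ / p̃(i)`. -/
noncomputable def stalkGenerator (p : Ideal k) (i : V) : stalkModule hR p i :=
  (1 : PathAlgebra k V ⧸ idealTilde p i)

theorem exists_smul_stalkGenerator {p : Ideal k} {i : V} (y : stalkModule hR p i) :
    ∃ a : QuotAlgebra R, a • stalkGenerator hR p i = y := by
  obtain ⟨ξ, rfl⟩ := Ideal.Quotient.mk_surjective (I := idealTilde p i) y
  refine ⟨Ideal.Quotient.mk _ ξ, ?_⟩
  exact mul_one (Ideal.Quotient.mk (idealTilde p i) ξ)

theorem smul_stalkGenerator_eq_zero_iff {p : Ideal k} {i : V} (a : QuotAlgebra R) :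
    a • stalkGenerator hR p i = 0 ↔ augmentation hR i a ∈ p := by
  obtain ⟨ξ, rfl⟩ := Ideal.Quotient.mk_surjective a
  have h : Ideal.Quotient.mk (relIdeal R) ξ • stalkGenerator hR p i =
      Ideal.Quotient.mk (idealTilde p i) ξ := mul_one (Ideal.Quotient.mk (idealTilde p i) ξ)
  rw [h, augmentation_mk]
  exact Ideal.Quotient.eq_zero_iff_mem

theorem smul_stalk_eq_zero {p : Ideal k} {i : V} {a : QuotAlgebra R}
    (ha : augmentation hR i a ∈ p) (y : stalkModule hR p i) : a • y = 0 := by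
  obtain ⟨b, rfl⟩ := exists_smul_stalkGenerator hR y
  rw [smul_smul, smul_stalkGenerator_eq_zero_iff, map_mul]
  exact p.mul_mem_right _ ha

theorem smul_stalk_eq_zero_iff {p : Ideal k} (hp : p.IsPrime) {i : V} (a : QuotAlgebra R)
    {y : stalkModule hR p i} (hy : y ≠ 0) : a • y = 0 ↔ augmentation hR i a ∈ p := by
  refine ⟨fun h => ?_, fun h => smul_stalk_eq_zero hR h y⟩
  obtain ⟨b, rfl⟩ := exists_smul_stalkGenerator hR y
  rw [smul_smul, smul_stalkGenerator_eq_zero_iff, map_mul] at h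
  exact (hp.mem_or_mem h).resolve_right
    fun h' => hy ((smul_stalkGenerator_eq_zero_iff hR b).2 h')

theorem stalkModule_isMonoform {p : Ideal k} (hp : p.IsPrime) (i : V) :
    IsMonoform (stalkModule hR p i) := by
  refine ⟨not_isZero_of_ne_zero (x := stalkGenerator hR p i) fun h => ?_, ?_⟩
  · have := (smul_stalkGenerator_eq_zero_iff hR (p := p) (i := i) 1).1 (by rw [h, smul_zero])
    rw [map_one] at this
    exact hp.ne_top ((Ideal.eq_top_iff_one p).2 this)
  · intro N n hn hN X f g hf hg
    by_contra hX
    obtain ⟨x, hx⟩ := exists_ne_zero_of_not_isZero hX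
    obtain ⟨y, hy⟩ := exists_ne_zero_of_not_isZero hN
    obtain ⟨b, hb⟩ := exists_smul_stalkGenerator hR (n y)
    have hbp : augmentation hR i b ∉ p := fun h => map_ne_zero_of_mono n hn hy
      (hb.symm.trans ((smul_stalkGenerator_eq_zero_iff hR b).2 h))
    -- On the generator b acts as the scalar c, so c times the generator lies in the image of N.
    -- Being central, c kills the whole cokernel, whereas it kills no non-zero element of the stalk
    -- module because its value is outside p.
    set c := algebraMap k (QuotAlgebra R) (augmentation hR i b) with hc
    have hcb : (c - b) • stalkGenerator hR p i = 0 := by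
      rw [smul_stalkGenerator_eq_zero_iff, map_sub, hc, augmentation_algebraMap, sub_self]
      exact p.zero_mem
    rw [sub_smul, sub_eq_zero, hb] at hcb
    have hcg : c • g x = 0 := by
      obtain ⟨z, hz⟩ := cokernel_π_surjective n (g x)
      obtain ⟨a, rfl⟩ := exists_smul_stalkGenerator hR z
      rw [← hz, ← map_smul (cokernel.π n).hom]
      refine (cokernel_π_eq_zero_iff n _).2 ⟨a • y, ?_⟩
      rw [smul_smul, hc, Algebra.commutes, mul_smul, ← hc, hcb]
      exact map_smul n.hom a y
    rw [smul_eq_zero_iff_of_mono g hg, ← smul_eq_zero_iff_of_mono f hf,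
      smul_stalk_eq_zero_iff hR hp _ (map_ne_zero_of_mono f hf hx), hc,
      augmentation_algebraMap] at hcg
    exact hbp hcg

theorem exists_mono_stalkModule {p : Ideal k} {i : V} {H : ModuleCat.{max u v w} (QuotAlgebra R)}
    {x : H} (h : ∀ a : QuotAlgebra R, a • x = 0 ↔ augmentation hR i a ∈ p) :
    ∃ f : stalkModule hR p i ⟶ H, Mono f := by
  obtain ⟨g, hg⟩ := exists_hom_of_generator (n := x)
    (exists_smul_stalkGenerator hR (p := p) (i := i))
    fun a ha => (h a).2 ((smul_stalkGenerator_eq_zero_iff hR a).1 ha)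
  refine ⟨g, ?_⟩
  rw [ModuleCat.mono_iff_injective]
  refine (injective_iff_map_eq_zero g.hom).2 fun y (hy : g y = 0) => ?_
  obtain ⟨a, rfl⟩ := exists_smul_stalkGenerator hR y
  rw [hg, h] at hy
  exact (smul_stalkGenerator_eq_zero_iff hR a).2 hy

theorem exists_epi_stalkModule {p q : Ideal k} (hpq : p ≤ q) (i : V) :
    ∃ f : stalkModule hR p i ⟶ stalkModule hR q i, Epi f := by
  obtain ⟨g, hg⟩ := exists_hom_of_generator (n := stalkGenerator hR q i)
    (exists_smul_stalkGenerator hR (p := p) (i := i)) fun a ha =>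
      (smul_stalkGenerator_eq_zero_iff hR a).2
        (hpq ((smul_stalkGenerator_eq_zero_iff hR a).1 ha))
  refine ⟨g, ?_⟩
  rw [ModuleCat.epi_iff_surjective]
  intro y
  obtain ⟨a, rfl⟩ := exists_smul_stalkGenerator hR y
  exact ⟨_, hg a⟩

/-- The map sending `p` in the `i`-th copy of the spectrum to the atom of `kQ / p̃(i)`. -/
noncomputable def stalkAtom (x : Σ _ : V, SpecSC k) :
    ASpec (ModuleCat.{max u v w} (QuotAlgebra R)) :=
  atom (stalkModule hR x.2.asIdeal x.1) (stalkModule_isMonoform hR x.2.isPrime x.1)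

/-- Monomorphisms preserve annihilators of elements, and all non-zero elements of the stalk module
have the same one. Conversely, an element with this annihilator generates a copy of the stalk module
inside H. -/
theorem atom_eq_stalkAtom_iff {H : ModuleCat.{max u v w} (QuotAlgebra R)} (hH : IsMonoform H)
    (y : Σ _ : V, SpecSC k) : atom H hH = stalkAtom hR y ↔
      ∃ x : H, ∀ a : QuotAlgebra R, a • x = 0 ↔ augmentation hR y.1 a ∈ y.2.asIdeal := by
  refine ⟨fun h => ?_, fun ⟨x, h⟩ => ?_⟩
  · obtain ⟨X, f, g, hf, hg, hX⟩ : AtomEquiv H _ := Quotient.exact h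
    obtain ⟨x, hx⟩ := exists_ne_zero_of_not_isZero hX
    exact ⟨f x, fun a => (smul_eq_zero_iff_of_mono f hf a x).trans <|
      (smul_eq_zero_iff_of_mono g hg a x).symm.trans <|
        smul_stalk_eq_zero_iff hR y.2.isPrime a (map_ne_zero_of_mono g hg hx)⟩
  · obtain ⟨f, hf⟩ := exists_mono_stalkModule hR h
    exact Quotient.sound ⟨_, f, 𝟙 _, hf, inferInstance,
      (stalkModule_isMonoform hR y.2.isPrime y.1).1⟩

/-- Each a acts on x as the scalar given by its augmentation, so the annihilator of x is the
preimage of its ideal of scalars, which is prime because H is monoform. -/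
theorem exists_atom_eq_stalkAtom {H : ModuleCat.{max u v w} (QuotAlgebra R)} (hH : IsMonoform H)
    {x : H} (hx : x ≠ 0) {i : V}
    (h : ∀ a : QuotAlgebra R, augmentation hR i a = 0 → a • x = 0) :
    ∃ q : SpecSC k, atom H hH = stalkAtom hR ⟨i, q⟩ ∧
      ∀ c, algebraMap k (QuotAlgebra R) c • x = 0 → c ∈ q.asIdeal := by
  let q : Ideal k :=
    { carrier := {c | algebraMap k (QuotAlgebra R) c • x = 0}
      add_mem' := fun {a b} (ha : _ = 0) (hb : _ = 0) => by
        change _ = _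
        rw [map_add, add_smul, ha, hb, add_zero]
      zero_mem' := by
        change _ = _
        rw [map_zero, zero_smul]
      smul_mem' := fun c a (ha : _ = 0) => by
        change _ = _
        rw [smul_eq_mul, map_mul, mul_smul, ha, smul_zero] }
  have hmem : ∀ c, c ∈ q ↔ algebraMap k (QuotAlgebra R) c • x = 0 := fun c => Iff.rfl
  have hq : q.IsPrime := by
    refine ⟨fun h => hx ?_, fun {c d} hcd => ?_⟩
    · have := (hmem 1).1 (h ▸ Submodule.mem_top)
      rwa [map_one, one_smul] at this
    · rw [hmem, map_mul, mul_smul] at hcd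
      exact hH.smul_eq_zero_or x c d hcd
  refine ⟨(⟨q, hq⟩ : PrimeSpectrum k), (atom_eq_stalkAtom_iff hR hH _).2 ⟨x, fun a => ?_⟩,
    fun c hc => hc⟩
  have h0 := h (a - algebraMap k (QuotAlgebra R) (augmentation hR i a))
    (by rw [map_sub, augmentation_algebraMap, sub_self])
  rw [sub_smul, sub_eq_zero] at h0
  rw [h0]
  exact (hmem _).symm

theorem stalkAtom_injective : Function.Injective (stalkAtom hR) := by
  rintro ⟨i, p⟩ ⟨j, q⟩ h
  obtain ⟨x, hx⟩ := (atom_eq_stalkAtom_iff hR (stalkModule_isMonoform hR p.isPrime i) _).1 h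
  have hx0 : x ≠ 0 := fun h0 => by
    have := (hx 1).1 (by rw [h0, smul_zero])
    rw [map_one] at this
    exact q.isPrime.ne_top ((Ideal.eq_top_iff_one _).2 this)
  have key : ∀ a : QuotAlgebra R, augmentation hR i a ∈ p.asIdeal ↔
      augmentation hR j a ∈ q.asIdeal := fun a =>
    (smul_stalk_eq_zero_iff hR p.isPrime a hx0).symm.trans (hx a)
  obtain rfl : i = j := by
    by_contra hij
    -- The class of `e_i` separates vertices: its augmentation is 1 at i and 0 at j.
    have := (key (Ideal.Quotient.mk _ (PathAlgebra.ofPath k (trivialPath i)))).2 (by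
      rw [augmentation_mk, coeff_ofPath_of_ne fun h => hij (trivialPath_injective h).symm]
      exact q.asIdeal.zero_mem)
    rw [augmentation_mk, coeff_trivialPath_self] at this
    exact p.isPrime.ne_top ((Ideal.eq_top_iff_one _).2 this)
  have hpq : p.asIdeal = q.asIdeal := by
    ext c
    simpa only [augmentation_algebraMap] using key (algebraMap k (QuotAlgebra R) c)
  rw [le_antisymm ((SpecSC.le_iff _ p q).2 hpq.le) ((SpecSC.le_iff _ q p).2 hpq.ge)]

/-- A monoform H with the atom of kQ/p̃(i) contains a copy of that module, which maps onto kQ/q̃(i)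
for q ⊇ p; so the atom support of H contains the atoms of all such q. -/
theorem stalkAtom_continuous : Continuous (stalkAtom hR) := by
  refine ⟨fun Φ hΦ => isOpen_sigma_iff.2 fun i p q hpq hp => ?_⟩
  obtain ⟨H, hH, he, hs⟩ := hΦ _ hp
  obtain ⟨x, hx⟩ := (atom_eq_stalkAtom_iff hR hH _).1 he
  obtain ⟨m, hm⟩ := exists_mono_stalkModule hR hx
  obtain ⟨g, hg⟩ := exists_epi_stalkModule hR hpq i
  exact hs (mem_ASupp_of_epi _ m hm g hg)

/-- Every subquotient is still killed by the preimage of p under the augmentation, so the prime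
attached to a monoform one contains p. -/
theorem ASupp_stalkModule_subset (i : V) (p : SpecSC k) :
    ASupp (stalkModule hR p.asIdeal i) ⊆ stalkAtom hR '' {y | ∃ q, p ≤ q ∧ y = ⟨i, q⟩} := by
  rintro _ ⟨H, hH, rfl, L, L', l, j, hl, hj, ⟨e⟩⟩
  obtain ⟨x, hx⟩ := exists_ne_zero_of_not_isZero hH.1
  have hann : ∀ a : QuotAlgebra R, augmentation hR i a ∈ p.asIdeal → a • x = 0 := fun a ha =>
    smul_eq_zero_of_subquotient l hl j e (smul_stalk_eq_zero hR ha) x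
  obtain ⟨q, hq, hqc⟩ := exists_atom_eq_stalkAtom hR hH hx
    fun a ha => hann a (ha ▸ p.asIdeal.zero_mem)
  refine ⟨⟨i, q⟩, ⟨q, (SpecSC.le_iff _ p q).2 fun c hc => hqc c (hann _ ?_), rfl⟩, hq.symm⟩
  rwa [augmentation_algebraMap]

theorem stalkAtom_isOpenMap : IsOpenMap (stalkAtom hR) := by
  rintro U hU _ ⟨⟨i, p⟩, hp, rfl⟩
  refine ⟨_, _, rfl, (ASupp_stalkModule_subset hR i p).trans (Set.image_mono ?_)⟩
  rintro _ ⟨q, hpq, rfl⟩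
  exact isOpen_sigma_iff.1 hU i hpq hp

end Augmentation

/-! ### From the linearized path category to the path algebra -/

section RightRooted

variable {k : Type u} [CommRing k] {V : Type v} [Quiver.{w} V]

/-- A morphism of the linearized path category, as an element of the path algebra. -/
noncomputable def homToPathAlgebra (i j : V) :
    (vertex k i ⟶ vertex k j) →ₗ[k] PathAlgebra k V :=
  Finsupp.lmapDomain k k (fun p : Quiver.Path i j => (⟨i, j, p⟩ : AllPaths V))

theorem homToPathAlgebra_single {i j : V} (p : Quiver.Path i j) (c : k) :
    homToPathAlgebra i j (Finsupp.single p c : Quiver.Path i j →₀ k) =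
      c • PathAlgebra.ofPath k ⟨i, j, p⟩ :=
  (Finsupp.mapDomain_single).trans
    ((Finsupp.smul_single_one (⟨i, j, p⟩ : AllPaths V) c).symm)

variable [Fintype V]

/-- Both sides are bilinear, so paths suffice. The factors swap because f ≫ g applies f first, as
the product gf does. -/
theorem homToPathAlgebra_comp {i j l : V} (f : vertex k i ⟶ vertex k j)
    (g : vertex k j ⟶ vertex k l) :
    homToPathAlgebra i l (f ≫ g) = homToPathAlgebra j l g * homToPathAlgebra i j f := by
  have h : homToPathAlgebra i l ∘ₗ (Linear.rightComp k (vertex k i) g) =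
      LinearMap.mulLeft k (homToPathAlgebra j l g) ∘ₗ homToPathAlgebra i j := by
    refine Finsupp.lhom_ext fun (p : Quiver.Path i j) c => ?_
    have h' : homToPathAlgebra i l ∘ₗ (Linear.leftComp k (X := vertex k i) (Y := vertex k j) (vertex k l)
        (Finsupp.single p c : Quiver.Path i j →₀ k)) =
        LinearMap.mulRight k (c • PathAlgebra.ofPath k ⟨i, j, p⟩) ∘ₗ homToPathAlgebra j l := by
      refine Finsupp.lhom_ext fun (q : Quiver.Path j l) d => ?_
      have hs := congrArg (homToPathAlgebra (k := k) i l) (Free.single_comp_single (R := k) (C := Paths V)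
        (X := (Paths.of V).obj i) (Y := (Paths.of V).obj j) (Z := (Paths.of V).obj l) p q c d)
      refine (hs.trans (homToPathAlgebra_single _ _)).trans ?_
      change _ = homToPathAlgebra j l (Finsupp.single q d : Quiver.Path j l →₀ k) *
        (c • PathAlgebra.ofPath k ⟨i, j, p⟩)
      rw [homToPathAlgebra_single, smul_mul_smul_comm, PathAlgebra.ofPath_mul_ofPath,
        PathAlgebra.pathMul_comp, mul_comm c d]
      rfl
    refine (LinearMap.congr_fun h' g).trans ?_
    exact congrArg (homToPathAlgebra j l g * ·) (homToPathAlgebra_single p c).symm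
  exact LinearMap.congr_fun h f

theorem homToPathAlgebra_linPath {i j : V} (p : Quiver.Path i j) :
    homToPathAlgebra i j (linPath k p) = PathAlgebra.ofPath k ⟨i, j, p⟩ :=
  (homToPathAlgebra_single p 1).trans (one_smul _ _)

/-- Right rootedness speaks of the ideal in the category; this transfers it to kQ, so that the
initial path it provides acts as zero on modules. -/
theorem homToPathAlgebra_mem_relIdeal {R : Set (Relation k V)} {i j : V}
    {f : vertex k i ⟶ vertex k j} (hf : f ∈ catIdeal R (vertex k i) (vertex k j)) :
    homToPathAlgebra i j f ∈ relIdeal R := by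
  have h : catIdeal R (vertex k i) (vertex k j) ≤
      ((relIdeal R).restrictScalars k).comap (homToPathAlgebra i j) := by
    refine Submodule.span_le.2 ?_
    rintro _ ⟨ρ, hρ, α, β, rfl⟩
    change homToPathAlgebra i j (α ≫ ρ.hom ≫ β) ∈ relIdeal R
    rw [homToPathAlgebra_comp, homToPathAlgebra_comp]
    refine Ideal.mul_mem_right _ _ (Ideal.mul_mem_left _ _ ?_)
    exact TwoSidedIdeal.mem_asIdeal.2 (TwoSidedIdeal.subset_span ⟨ρ, hρ, rfl⟩)
  exact h hf

variable {R : Set (Relation k V)}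

/-- A path, as an element of `kQ / I`. -/
noncomputable def pathClass (R : Set (Relation k V)) {i j : V} (p : Quiver.Path i j) :
    QuotAlgebra R :=
  Ideal.Quotient.mk (relIdeal R) (PathAlgebra.ofPath k ⟨i, j, p⟩)

theorem pathClass_mul_pathClass {i j l : V} (p : Quiver.Path i j) (q : Quiver.Path j l) :
    pathClass R q * pathClass R p = pathClass R (p.comp q) := by
  rw [pathClass, pathClass, ← map_mul, PathAlgebra.ofPath_mul_ofPath, PathAlgebra.pathMul_comp]
  rfl

theorem pathClass_mul_pathClass_of_ne {i j i' j' : V} (p : Quiver.Path i j)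
    (q : Quiver.Path i' j') (h : j ≠ i') : pathClass R q * pathClass R p = 0 := by
  rw [pathClass, pathClass, ← map_mul, PathAlgebra.ofPath_mul_ofPath,
    PathAlgebra.pathMul_of_ne _ h, map_zero]

theorem one_eq_sum_pathClass : (1 : QuotAlgebra R) = ∑ i : V, pathClass R (Quiver.Path.nil : Quiver.Path i i) := by
  rw [← map_one (Ideal.Quotient.mk (relIdeal R)), PathAlgebra.one_def, map_sum]
  rfl

/-! ### Right rootedness and surjectivity -/

variable {H : Type*} [AddCommGroup H] [Module (QuotAlgebra R) H]

/-- Under right rootedness a non-zero element is moved by a path to a non-zero element killed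
by all arrows. -/
theorem IsRightRooted.exists_killed_by_arrows (hrr : IsRightRooted R) {x : H} (hx : x ≠ 0) :
    ∃ (i : V) (y : H), y ≠ 0 ∧ pathClass R (Quiver.Path.nil : Quiver.Path i i) • y = y ∧
      ∀ (j : V) (a : i ⟶ j), pathClass R a.toPath • y = 0 := by
  by_contra! hno
  obtain ⟨i, hi⟩ : ∃ i : V, pathClass R (Quiver.Path.nil : Quiver.Path i i) • x ≠ 0 := by
    by_contra! h
    refine hx ?_
    rw [← one_smul (QuotAlgebra R) x, one_eq_sum_pathClass, Finset.sum_smul]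
    exact Finset.sum_eq_zero fun i _ => h i
  -- If no such element exists, each non-zero element located at a vertex is moved by some arrow to
  -- another. Iterating from `e_i` • x yields an infinite sequence of arrows none of whose initial
  -- paths kills `e_i` • x, against right rootedness.
  let T := {s : Σ _ : V, H // s.2 ≠ 0 ∧ pathClass R (Quiver.Path.nil : Quiver.Path s.1 s.1) • s.2 = s.2}
  have step : ∀ s : T, ∃ (t : T) (a : s.1.1 ⟶ t.1.1), t.1.2 = pathClass R a.toPath • s.1.2 := by
    rintro ⟨⟨i, y⟩, hy, hiy⟩
    obtain ⟨j, a, ha⟩ := hno i y hy hiy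
    refine ⟨⟨⟨j, pathClass R a.toPath • y⟩, ha, ?_⟩, a, rfl⟩
    rw [smul_smul, pathClass_mul_pathClass]
    rfl
  choose next arrow hnext using step
  let s : ℕ → T := fun n => Nat.rec ⟨⟨i, pathClass R (Quiver.Path.nil : Quiver.Path i i) • x⟩, hi, by
    rw [smul_smul, pathClass_mul_pathClass]; rfl⟩ (fun _ t => next t) n
  let v : ℕ → V := fun n => (s n).1.1
  let a : ∀ n, v n ⟶ v (n + 1) := fun n => arrow (s n)
  have hs : ∀ n, (s n).1.2 = pathClass R (initialPath v a n) • (s 0).1.2 := by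
    intro n
    induction n with
    | zero => exact (s 0).2.2.symm
    | succ n ih =>
      refine (hnext (s n)).trans ?_
      rw [ih, smul_smul, pathClass_mul_pathClass]
      rfl
  obtain ⟨N, -, hN⟩ := hrr v a
  refine (s N).2.1 ?_
  have h := homToPathAlgebra_mem_relIdeal hN
  rw [homToPathAlgebra_linPath] at h
  rw [hs, show pathClass R (initialPath v a N) = 0 from Ideal.Quotient.eq_zero_iff_mem.2 h,
    zero_smul]

theorem pathClass_smul_eq_zero {i : V} {y : H} (hy : pathClass R (Quiver.Path.nil : Quiver.Path i i) • y = y)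
    (ha : ∀ (j : V) (a : i ⟶ j), pathClass R a.toPath • y = 0) (p : AllPaths V)
    (hp : p ≠ trivialPath i) : pathClass R p.2.2 • y = 0 := by
  obtain ⟨i', j, p⟩ := p
  by_cases hi : i = i'
  · subst hi
    change pathClass R p • y = 0
    induction p with
    | nil => exact absurd rfl hp
    | cons p a ih =>
      rename_i b c
      -- The arrow a is applied last: either it is the whole path, or the non-trivial initial part p
      -- already kills y.
      by_cases hp' : (⟨i, b, p⟩ : AllPaths V) = trivialPath i
      · cases p with
        | nil => exact ha _ a
        | cons p a' =>
          exact absurd (congrArg (fun q : AllPaths V => q.2.2.length) hp') (Nat.succ_ne_zero _)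
      · rw [show p.cons a = p.comp a.toPath from rfl, ← pathClass_mul_pathClass, mul_smul,
          ih hp', smul_zero]
  · rw [← hy, smul_smul, pathClass_mul_pathClass_of_ne _ _ hi, zero_smul]

theorem smul_eq_augmentation_smul (hR : ∀ ρ ∈ R, ρ.IsAdmissible) {i : V} {y : H}
    (hy : pathClass R (Quiver.Path.nil : Quiver.Path i i) • y = y)
    (ha : ∀ (j : V) (a : i ⟶ j), pathClass R a.toPath • y = 0) (a : QuotAlgebra R) :
    a • y = algebraMap k (QuotAlgebra R) (augmentation hR i a) • y := by
  -- With H viewed as a k-module through the scalars, both sides are k-linear in a lift ξ of a, and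
  -- it suffices to compare them on paths.
  let : Module k H := Module.compHom H (algebraMap k (QuotAlgebra R))
  have : IsScalarTower k (QuotAlgebra R) H := ⟨fun c a y => by
    rw [Algebra.smul_def, mul_smul]; rfl⟩
  obtain ⟨ξ, rfl⟩ := Ideal.Quotient.mk_surjective a
  have h : (LinearMap.toSpanSingleton (QuotAlgebra R) H y).restrictScalars k ∘ₗ
      (Ideal.Quotient.mkₐ k (relIdeal R)).toLinearMap =
      LinearMap.toSpanSingleton k H y ∘ₗ PathAlgebra.coeff k (trivialPath i) := by
    refine PathAlgebra.hom_ext fun p => ?_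
    change pathClass R p.2.2 • y = PathAlgebra.coeff k (trivialPath i) (PathAlgebra.ofPath k p) • y
    by_cases hp : p = trivialPath i
    · subst hp
      rw [coeff_trivialPath_self, one_smul]
      exact hy
    · rw [coeff_ofPath_of_ne (Ne.symm hp), zero_smul]
      exact pathClass_smul_eq_zero hy ha p hp
  exact LinearMap.congr_fun h ξ

theorem stalkAtom_surjective (hR : ∀ ρ ∈ R, ρ.IsAdmissible) (hrr : IsRightRooted R) :
    Function.Surjective (stalkAtom hR) := by
  intro b
  obtain ⟨⟨H, hH⟩, rfl⟩ := Quotient.exists_rep b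
  obtain ⟨x, hx⟩ := exists_ne_zero_of_not_isZero hH.1
  obtain ⟨i, y, hy, hiy, ha⟩ := hrr.exists_killed_by_arrows hx
  obtain ⟨q, hq, -⟩ := exists_atom_eq_stalkAtom hR hH hy (i := i) fun a h0 => by
    rw [smul_eq_augmentation_smul hR hiy ha, h0, map_zero, zero_smul]
  exact ⟨⟨i, q⟩, hq.symm⟩

end RightRooted

end QuiverAtoms

/-! ### The theorem -/

theorem theoremA {k : Type u} [CommRing k] {V : Type v} [Quiver.{w} V] [Fintype V]
    (R : Set (Relation k V)) (hR : ∀ ρ ∈ R, ρ.IsAdmissible) :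
    ∃ f : (Σ _ : V, SpecSC k) → ASpec (ModuleCat.{max u v w} (QuotAlgebra R)),
      (∀ (i : V) (p : SpecSC k), ∃ h : IsMonoform (stalkModule hR p.asIdeal i),
        f ⟨i, p⟩ = atom (stalkModule hR p.asIdeal i) h) ∧
      Function.Injective f ∧ Continuous f ∧ IsOpenMap f ∧ Monotone f ∧
      (IsRightRooted R →
        Function.Surjective f ∧ IsHomeomorph f ∧ ∀ x y, f x ≤ f y ↔ x ≤ y) := by
  have hc := stalkAtom_continuous hR
  have hi := stalkAtom_injective hR
  have ho := stalkAtom_isOpenMap hR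
  refine ⟨stalkAtom hR, fun i p => ⟨stalkModule_isMonoform hR p.isPrime i, rfl⟩, hi, hc, ho,
    fun x y hxy => ((specializes_sigma_iff x y).2 hxy).map hc, fun hrr => ?_⟩
  have hs := stalkAtom_surjective hR hrr
  refine ⟨hs, ⟨hc, ho, hi, hs⟩, fun x y => Iff.trans ?_ (specializes_sigma_iff x y)⟩
  -- An open embedding both preserves and reflects specialization, which is the reverse of the order
  -- on either side.
  exact (Topology.IsOpenEmbedding.of_continuous_injective_isOpenMap hc hi ho).isInducing.specializes_iff
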